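/- **Infinitesimal Rigid Displacement Lemma.** Let $\Omega\subset\mathbb R^3$ be a Lipschitz domain, that is, a nonempty connected open set such that every point of $\partial\Omega$ has an open neighbourhood $U$ and a bijective bi-Lipschitz map $\varphi:(-1,1)^3\to U$ which maps $(-1,1)^2\times(0,1)$ onto $U\cap\Omega$ and $(-1,1)^2\times\{0\}$ onto $U\cap\partial\Omega$. Let $p,q\in(1,\infty)$ with $1/p+1/q=1$, let $\Phi\in W^{1,p}(\Omega;\mathbb R^3)$ and $\Psi\in W^{1,\infty}(\Omega;\mathbb R^3)\cap W^{2,q}(\Omega;\mathbb R^3)$, and let $\nabla\Phi,\nabla\Psi$ denote their (weak) Jacobian matrices, $(\nabla\Phi)_{ij}=\partial_j\Phi_i$. Suppose that there is a constant $c^+>0$ with $\det\nabla\Psi\ge c^+$ a.e. in $\Omega$, and that $$\operatorname{sym}(\nabla\Phi^\top\nabla\Psi)=0\quad\text{a.e. in }\Omega,\qquad\text{where }\operatorname{sym}M:=\tfrac12(M+M^\top).$$ Then there exist a constant skew-symmetric matrix $A\in\mathfrak{so}(3)$ and a constant vector $a\in\mathbb R^3$ such that $\Phi=A\Psi+a$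 a.e. in $\Omega$. -/

import Mathlib

open MeasureTheory Set
open scoped ContDiff Matrix

/-- `v` is the weak partial derivative `∂ⱼ u` in the open set `Ω ⊆ ℝⁿ`: both functions are locally
integrable in `Ω`, and `∫_Ω u ∂ⱼφ = - ∫_Ω v φ` for every test function `φ ∈ C_c^∞(Ω)`. -/
def HasWeakPartial {n : ℕ} (Ω : Set (EuclideanSpace ℝ (Fin n))) (j : Fin n)
    (u v : EuclideanSpace ℝ (Fin n) → ℝ) : Prop :=
  LocallyIntegrableOn u Ω volume ∧ LocallyIntegrableOn v Ω volume ∧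
    ∀ φ : EuclideanSpace ℝ (Fin n) → ℝ, ContDiff ℝ ∞ φ → HasCompactSupport φ → tsupport φ ⊆ Ω →
      ∫ x in Ω, u x * fderiv ℝ φ x (EuclideanSpace.single j 1) = - ∫ x in Ω, v x * φ x

/-- The Sobolev space `W^{k,p}(Ω)` of real functions on the open set `Ω ⊆ ℝⁿ`: all weak
derivatives of order at most `k` exist and lie in `L^p(Ω)`. -/
def MemSobolev {n : ℕ} (Ω : Set (EuclideanSpace ℝ (Fin n))) (p : ENNReal) :
    ℕ → (EuclideanSpace ℝ (Fin n) → ℝ) → Prop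
  | 0, u => MemLp u p (volume.restrict Ω)
  | k + 1, u => MemLp u p (volume.restrict Ω) ∧
      ∀ j : Fin n, ∃ v : EuclideanSpace ℝ (Fin n) → ℝ,
        HasWeakPartial Ω j u v ∧ MemSobolev Ω p k v

/-- The Sobolev space `W^{k,p}(Ω; ℝᵐ)` of vector fields, componentwise. -/
def MemSobolevVec {n m : ℕ} (Ω : Set (EuclideanSpace ℝ (Fin n))) (p : ENNReal) (k : ℕ)
    (u : EuclideanSpace ℝ (Fin n) → EuclideanSpace ℝ (Fin m)) : Prop :=
  ∀ i : Fin m, MemSobolev Ω p k (fun x => u x i)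

/-- `G` is (a representative of) the weak Jacobian `∇u` of the vector field `u` in `Ω`,
i.e. `G i j = ∂ⱼ uᵢ`; the rows of `∇u` are the gradients of the components of `u`. -/
def IsWeakJacobian {n m : ℕ} (Ω : Set (EuclideanSpace ℝ (Fin n)))
    (u : EuclideanSpace ℝ (Fin n) → EuclideanSpace ℝ (Fin m))
    (G : EuclideanSpace ℝ (Fin n) → Matrix (Fin m) (Fin n) ℝ) : Prop :=
  ∀ (i : Fin m) (j : Fin n), HasWeakPartial Ω j (fun x => u x i) (fun x => G x i j)

/-- The symmetric part `sym M = (M + Mᵀ) / 2` of a square matrix. -/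
noncomputable def symPart {n : ℕ} (M : Matrix (Fin n) (Fin n) ℝ) : Matrix (Fin n) (Fin n) ℝ :=
  (1 / 2 : ℝ) • (M + Mᵀ)

/-- The open cube `(-1,1)³`. -/
def openCube : Set (EuclideanSpace ℝ (Fin 3)) := {y | ∀ i, |y i| < 1}

/-- A Lipschitz domain in `ℝ³`: a nonempty connected open set such that every boundary point has
an open neighbourhood `U` and a bi-Lipschitz bijection `φ : (-1,1)³ → U` mapping
`(-1,1)² × (0,1)` onto `U ∩ Ω` and `(-1,1)² × {0}` onto `U ∩ ∂Ω`. -/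
def IsLipschitzDomain (Ω : Set (EuclideanSpace ℝ (Fin 3))) : Prop :=
  IsOpen Ω ∧ IsConnected Ω ∧
    ∀ x ∈ frontier Ω, ∃ (U : Set (EuclideanSpace ℝ (Fin 3)))
      (φ : EuclideanSpace ℝ (Fin 3) → EuclideanSpace ℝ (Fin 3)) (L : ℝ),
      IsOpen U ∧ x ∈ U ∧
      (∀ y ∈ openCube, ∀ z ∈ openCube,
        dist (φ y) (φ z) ≤ L * dist y z ∧ dist y z ≤ L * dist (φ y) (φ z)) ∧
      φ '' openCube = U ∧
      φ '' {y ∈ openCube | 0 < y 2} = U ∩ Ω ∧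
      φ '' {y ∈ openCube | y 2 = 0} = U ∩ frontier Ω

/-! Write W = ∇Φ and F = ∇Ψ. Conjugating sym(WᵀF) = 0 by F⁻¹ shows that WF⁻¹ is skew, so each column
of W is a × (column of F) for an axial field a (`axialMul_axialVector`). This field lies in L^p,
since F is bounded and det F ≥ c. If a is constant, Φ - a × Ψ has zero weak gradient and is constant
on the connected set Ω.

Were a smooth, the curl-free rows of W and F would give a linear system for ∇a, solvable because det
F ≠ 0. Since a has no derivative a priori, the solving is moved onto the test function. The rows of
W are tested against φ H(F), with H from `curlMultiplier` chosen so that the terms in ∇φ sum to a_m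
∂_l φ. The terms containing derivatives of F cancel by symmetry of the second derivatives of Ψ
(`sum_axialMul_mul_curl`). Hence ∫ a_m ∂_l φ = 0 for every φ.

Such test functions are admissible because W is in L^p and ∇(H(F)) in L^q: mollify F and pass to the
limit (`HasWeakPartial.integral_mul_comp_comm`). -/

open Filter Topology Convolution

/-! ### Mollification and its convergence -/

/-- A bump function at the origin of outer radius `2 / (k + 1)`. -/
noncomputable def shrinkingBump (E : Type*) [NormedAddCommGroup E] (k : ℕ) :
    ContDiffBump (0 : E) where
  rIn := 1 / (k + 1)
  rOut := 2 / (k + 1)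
  rIn_pos := by positivity
  rIn_lt_rOut := by gcongr; norm_num

lemma tendsto_shrinkingBump_rOut {E : Type*} [NormedAddCommGroup E] :
    Tendsto (fun k => (shrinkingBump E k).rOut) atTop (𝓝 0) := by
  have := (tendsto_one_div_add_atTop_nhds_zero_nat (𝕜 := ℝ)).const_mul 2
  simpa [shrinkingBump, div_eq_mul_inv] using this

section Mollification

variable {E : Type*} [NormedAddCommGroup E] [InnerProductSpace ℝ E] [FiniteDimensional ℝ E]
  [MeasurableSpace E] [BorelSpace E]

/-- The normalised smooth kernel associated with `shrinkingBump`. -/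
noncomputable def mollifier (k : ℕ) : E → ℝ := (shrinkingBump E k).normed volume

/-- The mollification of a function at scale `2 / (k + 1)`. -/
noncomputable def mollify (k : ℕ) (f : E → ℝ) (x : E) : ℝ := ∫ y, mollifier k (x - y) * f y

lemma mollifier_contDiff (k : ℕ) : ContDiff ℝ ∞ (mollifier k : E → ℝ) :=
  ContDiffBump.contDiff_normed _

lemma mollifier_hasCompactSupport (k : ℕ) : HasCompactSupport (mollifier k : E → ℝ) :=
  ContDiffBump.hasCompactSupport_normed _

lemma mollifier_nonneg (k : ℕ) (x : E) : 0 ≤ mollifier k x :=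
  ContDiffBump.nonneg_normed _ _

lemma integral_mollifier (k : ℕ) : ∫ x : E, mollifier k x = 1 :=
  ContDiffBump.integral_normed _

lemma integrable_mollifier (k : ℕ) : Integrable (mollifier k : E → ℝ) :=
  ContDiffBump.integrable_normed _

lemma tsupport_mollifier (k : ℕ) :
    tsupport (mollifier k : E → ℝ) = Metric.closedBall 0 (shrinkingBump E k).rOut :=
  ContDiffBump.tsupport_normed_eq _

lemma mollify_eq_convolution_left (k : ℕ) (f : E → ℝ) :
    mollify k f = (mollifier k) ⋆[ContinuousLinearMap.lsmul ℝ ℝ, volume] f := by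
  ext x
  rw [convolution_lsmul_swap]
  rfl

lemma mollify_eq_convolution_right (k : ℕ) (f : E → ℝ) :
    mollify k f = f ⋆[ContinuousLinearMap.mul ℝ ℝ, volume] (mollifier k) := by
  ext x
  rw [convolution_def]
  simp [mollify, mul_comm]

lemma mollify_apply (k : ℕ) (f : E → ℝ) (x : E) :
    mollify k f x = ∫ y, mollifier k y * f (x - y) := by
  rw [mollify_eq_convolution_left, convolution_def]
  rfl

lemma contDiff_mollify (k : ℕ) {f : E → ℝ} (hf : LocallyIntegrable f) :
    ContDiff ℝ ∞ (mollify k f) := by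
  rw [mollify_eq_convolution_right]
  exact (mollifier_hasCompactSupport k).contDiff_convolution_right _ hf (mollifier_contDiff k)

lemma integrable_mollifier_mul (k : ℕ) {f : E → ℝ} (hf : LocallyIntegrable f) (x : E) :
    Integrable (fun y => mollifier k y * f (x - y)) :=
  (mollifier_hasCompactSupport k).convolutionExists_left (ContinuousLinearMap.lsmul ℝ ℝ)
    (mollifier_contDiff k).continuous hf x

lemma ae_tendsto_mollify {f : E → ℝ} (hf : LocallyIntegrable f) :
    ∀ᵐ x, Tendsto (fun k => mollify k f x) atTop (𝓝 (f x)) := by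
  simp_rw [mollify_eq_convolution_left]
  refine ContDiffBump.ae_convolution_tendsto_right_of_locallyIntegrable (K := 2)
    tendsto_shrinkingBump_rOut (Eventually.of_forall fun k => ?_) hf
  simp [shrinkingBump, div_eq_mul_inv]

lemma abs_mollify_le (k : ℕ) {f : E → ℝ} {M : ℝ} (hf : ∀ᵐ x, |f x| ≤ M) (x : E) :
    |mollify k f x| ≤ M := by
  rw [mollify_apply]
  have hae : ∀ᵐ y : E, |f (x - y)| ≤ M :=
    (quasiMeasurePreserving_sub_left_of_right_invariant (volume : Measure E) x).ae hf
  calc |∫ y : E, mollifier k y * f (x - y)| ≤ ∫ y : E, mollifier k y * M := by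
        rw [← Real.norm_eq_abs]
        refine norm_integral_le_of_norm_le ((integrable_mollifier (E := E) k).mul_const M) ?_
        filter_upwards [hae] with y hy
        rw [norm_mul, Real.norm_of_nonneg (mollifier_nonneg k y)]
        exact mul_le_mul_of_nonneg_left hy (mollifier_nonneg k y)
    _ = M := by rw [integral_mul_const, integral_mollifier, one_mul]

lemma fderiv_mollify_apply (k : ℕ) {f : E → ℝ} (hf : LocallyIntegrable f) (x e : E) :
    fderiv ℝ (mollify k f) x e = ∫ y, f y * fderiv ℝ (mollifier k) (x - y) e := by
  have h := (mollifier_hasCompactSupport k).hasFDerivAt_convolution_right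
    (ContinuousLinearMap.mul ℝ ℝ) hf ((mollifier_contDiff k).of_le (by simp)) x
  rw [mollify_eq_convolution_right, h.fderiv, convolution_precompR_apply _ hf
    ((mollifier_hasCompactSupport k).fderiv ℝ)
    ((mollifier_contDiff k).continuous_fderiv (by simp))]
  rfl

lemma tendsto_eLpNorm_translate_sub {q : ENNReal} (hq : 1 ≤ q) (hq' : q ≠ ⊤) {v : E → ℝ}
    (hv : MemLp v q) : Tendsto (fun y => eLpNorm (fun x => v (x - y) - v x) q volume)
      (𝓝 0) (𝓝 0) := by
  have : Fact (1 ≤ q) := ⟨hq⟩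
  have : Fact (q ≠ ⊤) := ⟨hq'⟩
  have hc : Continuous fun y : E => (DomAddAct.mk (-y)) +ᵥ hv.toLp v := by
    have : Continuous fun y : E => DomAddAct.mk (-y) :=
      DomAddAct.continuous_mk.comp continuous_neg
    exact this.vadd continuous_const
  have h0 := (tendsto_iff_edist_tendsto_0.1 (hc.tendsto 0))
  refine h0.congr fun y => ?_
  have h1 : (DomAddAct.mk (-(0 : E))) +ᵥ hv.toLp v = hv.toLp v := by simp
  rw [h1, DomAddAct.mk_vadd_toLp, Lp.edist_toLp_toLp]
  refine eLpNorm_congr_ae (Eventually.of_forall fun x => ?_)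
  simp [vadd_eq_add, sub_eq_neg_add]

/-- The error `mollify k v - v` is an average of translation differences v(· - y) - v. Tonelli puts
the x-integral inside, Hölder pairs w with the difference, and continuity of translations in L^q
makes it small for y in the shrinking support. -/
lemma tendsto_lintegral_mul_mollify_sub {p q : ENNReal} [p.HolderConjugate q] (hq : 1 ≤ q)
    (hq' : q ≠ ⊤) {w v : E → ℝ} (hw : MemLp w p) (hv : MemLp v q) :
    Tendsto (fun k => ∫⁻ x, ‖w x‖ₑ * ‖mollify k v x - v x‖ₑ) atTop (𝓝 0) := by
  -- Tonelli needs joint measurability of (x, y) ↦ v(x - y), hence a measurable representative;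
  -- mollification does not see the change.
  wlog hvm : StronglyMeasurable v generalizing v
  · have hae := hv.1.ae_eq_mk
    have := this (hv.ae_eq hae) hv.1.stronglyMeasurable_mk
    refine this.congr fun k => lintegral_congr_ae ?_
    filter_upwards [hae] with x hx
    have : mollify k v x = mollify k (hv.1.mk v) x := by
      refine integral_congr_ae ?_
      filter_upwards [hae] with y hy
      rw [hy]
    rw [this, hx]
  have hloc : LocallyIntegrable v := hv.locallyIntegrable hq
  have hpt (k : ℕ) (x : E) : ‖mollify k v x - v x‖ₑ
      ≤ ∫⁻ y, ‖(mollifier k y : ℝ)‖ₑ * ‖v (x - y) - v x‖ₑ := by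
    have : mollify k v x - v x = ∫ y, mollifier k y * (v (x - y) - v x) := by
      simp_rw [mul_sub]
      rw [integral_sub (integrable_mollifier_mul k hloc x) ((integrable_mollifier k).mul_const _),
        integral_mul_const, integral_mollifier, one_mul, mollify_apply]
    rw [this]
    refine (enorm_integral_le_lintegral_enorm _).trans_eq ?_
    simp_rw [enorm_mul]
  have hmeas : Measurable fun z : E × E => ‖v (z.1 - z.2) - v z.1‖ₑ := by
    have := hvm.measurable
    fun_prop
  have hb (k : ℕ) : ∫⁻ x, ‖w x‖ₑ * ‖mollify k v x - v x‖ₑ ≤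
      ∫⁻ y, ‖(mollifier k y : ℝ)‖ₑ *
        (eLpNorm w p volume * eLpNorm (fun x => v (x - y) - v x) q volume) := by
    have hmk : Measurable fun y : E => ‖(mollifier k y : ℝ)‖ₑ :=
      (mollifier_contDiff k).continuous.measurable.enorm
    calc ∫⁻ x, ‖w x‖ₑ * ‖mollify k v x - v x‖ₑ
        ≤ ∫⁻ x, ∫⁻ y, ‖w x‖ₑ * (‖(mollifier k y : ℝ)‖ₑ * ‖v (x - y) - v x‖ₑ) := by
          refine lintegral_mono fun x => ?_
          rw [lintegral_const_mul]
          · gcongr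
            exact hpt k x
          · exact hmk.mul (hmeas.comp measurable_prodMk_left)
      _ = ∫⁻ y, ∫⁻ x, ‖w x‖ₑ * (‖(mollifier k y : ℝ)‖ₑ * ‖v (x - y) - v x‖ₑ) := by
          refine lintegral_lintegral_swap ?_
          exact (hw.1.enorm.comp_fst).mul ((hmk.comp measurable_snd).mul hmeas).aemeasurable
      _ = ∫⁻ y, ‖(mollifier k y : ℝ)‖ₑ * ∫⁻ x, ‖w x‖ₑ * ‖v (x - y) - v x‖ₑ := by
          refine lintegral_congr fun y => ?_
          rw [← lintegral_const_mul' _ _ enorm_ne_top]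
          exact lintegral_congr fun x => mul_left_comm _ _ _
      _ ≤ _ := by
          refine lintegral_mono fun y => ?_
          gcongr
          have h2 : AEStronglyMeasurable (fun x => v (x - y) - v x) volume := by
            have := hvm.measurable
            exact (by fun_prop : Measurable fun x => v (x - y) - v x).aestronglyMeasurable
          have h3 := eLpNorm_smul_le_mul_eLpNorm (p := p) (q := q) (r := 1) h2 hw.1
          refine le_trans (le_of_eq ?_) h3
          rw [eLpNorm_one_eq_lintegral_enorm]
          simp [enorm_mul]
  rw [ENNReal.tendsto_atTop_zero]
  intro ε hε
  have ht : Tendsto (fun y => eLpNorm w p volume * eLpNorm (fun x => v (x - y) - v x) q volume)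
      (𝓝 0) (𝓝 0) := by
    simpa using ENNReal.Tendsto.const_mul (tendsto_eLpNorm_translate_sub hq hq' hv)
      (Or.inr hw.2.ne)
  obtain ⟨δ, hδ, hball⟩ := Metric.eventually_nhds_iff.1 (ENNReal.tendsto_nhds_zero.1 ht ε hε)
  obtain ⟨N, hN⟩ := eventually_atTop.1
    (tendsto_shrinkingBump_rOut (E := E) |>.eventually (gt_mem_nhds hδ))
  refine ⟨N, fun k hk => (hb k).trans ?_⟩
  calc _ ≤ ∫⁻ y : E, ‖(mollifier k y : ℝ)‖ₑ * ε := by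
        refine lintegral_mono fun y => ?_
        by_cases hy : y ∈ tsupport (mollifier k : E → ℝ)
        · gcongr
          rw [tsupport_mollifier, Metric.mem_closedBall] at hy
          exact hball (hy.trans_lt (hN k hk))
        · simp [image_eq_zero_of_notMem_tsupport hy]
    _ = ε := by
        rw [lintegral_mul_const _ (mollifier_contDiff k).continuous.measurable.enorm,
          ← ofReal_integral_norm_eq_lintegral_enorm (integrable_mollifier k)]
        simp [Real.norm_of_nonneg (mollifier_nonneg k _), integral_mollifier]

end Mollification

/-! ### Calculus of weak partial derivatives -/

section WeakDerivative

variable {n : ℕ} {Ω : Set (EuclideanSpace ℝ (Fin n))} {j k : Fin n}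
  {u v w : EuclideanSpace ℝ (Fin n) → ℝ}

lemma MeasureTheory.LocallyIntegrableOn.integrableOn_mul_of_tsupport_subset
    (hu : LocallyIntegrableOn u Ω volume) {g : EuclideanSpace ℝ (Fin n) → ℝ} (hg : Continuous g)
    (hc : HasCompactSupport g) (hs : tsupport g ⊆ Ω) : IntegrableOn (fun x => u x * g x) Ω := by
  have h1 : IntegrableOn (fun x => u x * g x) (tsupport g) :=
    (hu.integrableOn_compact_subset hs hc).mul_continuousOn hg.continuousOn hc
  refine (integrableOn_iff_integrable_of_support_subset (fun x hx => ?_)).1 h1 |>.integrableOn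
  exact subset_tsupport g (right_ne_zero_of_mul hx)

namespace HasWeakPartial

lemma ae_unique (hΩ : IsOpen Ω) (hv : HasWeakPartial Ω j u v) (hw : HasWeakPartial Ω j u w) :
    v =ᵐ[volume.restrict Ω] w := by
  have h := hΩ.ae_eq_zero_of_integral_contDiff_smul_eq_zero (f := v - w)
    (μ := volume) (hv.2.1.sub hw.2.1) fun g hg hgc hgs => ?_
  · filter_upwards [(ae_restrict_iff' hΩ.measurableSet).2 h] with x hx
    exact sub_eq_zero.1 hx
  · have h1 := hv.2.2 g hg hgc hgs
    rw [hw.2.2 g hg hgc hgs, neg_inj] at h1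
    rw [← setIntegral_eq_integral_of_forall_compl_eq_zero (s := Ω) fun x hx => ?_]
    · have h2 : ∀ x, g x • (v - w) x = v x * g x - w x * g x := fun x => by
        simp only [Pi.sub_apply, smul_eq_mul]; ring
      simp_rw [h2]
      rw [integral_sub
        (hv.2.1.integrableOn_mul_of_tsupport_subset hg.continuous hgc hgs)
        (hw.2.1.integrableOn_mul_of_tsupport_subset hg.continuous hgc hgs), h1, sub_self]
    · rw [image_eq_zero_of_notMem_tsupport fun h => hx (hgs h), zero_smul]

lemma congr {u' v' : EuclideanSpace ℝ (Fin n) → ℝ} (h : HasWeakPartial Ω j u v)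
    (hu : u =ᵐ[volume.restrict Ω] u') (hv : v =ᵐ[volume.restrict Ω] v') :
    HasWeakPartial Ω j u' v' := by
  refine ⟨h.1.congr hu, h.2.1.congr hv, fun φ h1 h2 h3 => ?_⟩
  have e := h.2.2 φ h1 h2 h3
  rw [integral_congr_ae (g := fun x => u' x * fderiv ℝ φ x (EuclideanSpace.single j 1))] at e
  · rw [e, neg_inj]
    refine integral_congr_ae ?_
    filter_upwards [hv] with x hx
    rw [hx]
  · filter_upwards [hu] with x hx
    rw [hx]

lemma mono {Ω' : Set (EuclideanSpace ℝ (Fin n))} (h : HasWeakPartial Ω j u v) (hs : Ω' ⊆ Ω) :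
    HasWeakPartial Ω' j u v := by
  refine ⟨h.1.mono_set hs, h.2.1.mono_set hs, fun φ h1 h2 h3 => ?_⟩
  have key : ∀ f : EuclideanSpace ℝ (Fin n) → ℝ, (∀ x ∉ tsupport φ, f x = 0) →
      ∫ x in Ω', f x = ∫ x in Ω, f x := fun f hf => by
    rw [setIntegral_eq_integral_of_forall_compl_eq_zero fun x hx => hf x fun h => hx (h3 h),
      setIntegral_eq_integral_of_forall_compl_eq_zero fun x hx => hf x fun h => hx (hs (h3 h))]
  rw [key, key, h.2.2 φ h1 h2 (h3.trans hs)]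
  · intro x hx
    rw [image_eq_zero_of_notMem_tsupport hx, mul_zero]
  · intro x hx
    rw [image_eq_zero_of_notMem_tsupport
      fun h => hx (tsupport_fderiv_apply_subset ℝ (EuclideanSpace.single j 1) h), mul_zero]

lemma add {u' v' : EuclideanSpace ℝ (Fin n) → ℝ} (h : HasWeakPartial Ω j u v)
    (h' : HasWeakPartial Ω j u' v') :
    HasWeakPartial Ω j (fun x => u x + u' x) (fun x => v x + v' x) := by
  refine ⟨h.1.add h'.1, h.2.1.add h'.2.1, fun φ h1 h2 h3 => ?_⟩
  have c1 : Continuous fun x => fderiv ℝ φ x (EuclideanSpace.single j 1) :=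
    (h1.continuous_fderiv (by simp)).clm_apply continuous_const
  have c2 := h2.fderiv_apply ℝ (EuclideanSpace.single j 1)
  have c3 := (tsupport_fderiv_apply_subset ℝ (f := φ) (EuclideanSpace.single j 1)).trans h3
  simp_rw [add_mul]
  rw [integral_add (h.1.integrableOn_mul_of_tsupport_subset c1 c2 c3)
    (h'.1.integrableOn_mul_of_tsupport_subset c1 c2 c3),
    integral_add (h.2.1.integrableOn_mul_of_tsupport_subset h1.continuous h2 h3)
    (h'.2.1.integrableOn_mul_of_tsupport_subset h1.continuous h2 h3), h.2.2 φ h1 h2 h3,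
    h'.2.2 φ h1 h2 h3]
  ring

lemma const_mul (h : HasWeakPartial Ω j u v) (c : ℝ) :
    HasWeakPartial Ω j (fun x => c * u x) (fun x => c * v x) := by
  refine ⟨h.1.smul c, h.2.1.smul c, fun φ h1 h2 h3 => ?_⟩
  simp_rw [mul_assoc]
  rw [integral_const_mul, integral_const_mul, h.2.2 φ h1 h2 h3, mul_neg]

/-- Weak gradients are curl-free. -/
lemma integral_mul_fderiv_comm (hv : HasWeakPartial Ω j u v) (hw : HasWeakPartial Ω k u w)
    {η : EuclideanSpace ℝ (Fin n) → ℝ} (h1 : ContDiff ℝ ∞ η) (h2 : HasCompactSupport η)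
    (h3 : tsupport η ⊆ Ω) :
    ∫ x in Ω, v x * fderiv ℝ η x (EuclideanSpace.single k 1) =
      ∫ x in Ω, w x * fderiv ℝ η x (EuclideanSpace.single j 1) := by
  have hd : ContDiff ℝ ∞ (fderiv ℝ η) := h1.fderiv_right (by simp)
  have hs (e e' : EuclideanSpace ℝ (Fin n)) (x) :
      fderiv ℝ (fun y => fderiv ℝ η y e) x e' = fderiv ℝ (fderiv ℝ η) x e' e := by
    rw [fderiv_clm_apply (hd.differentiable (by simp) x) (differentiableAt_const _)]
    simp
  have hsymm (x e e') : fderiv ℝ (fderiv ℝ η) x e' e = fderiv ℝ (fderiv ℝ η) x e e' :=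
    (h1.contDiffAt.isSymmSndFDerivAt (by
      rw [minSmoothness_of_isRCLikeNormedField]
      exact WithTop.coe_le_coe.2 (le_top : (2 : ℕ∞) ≤ ⊤))).eq e' e
  -- Each weak derivative is tested with the other partial derivative of η; both integrals become
  -- that of u against the same mixed second derivative.
  have e1 := hv.2.2 _ (hd.clm_apply contDiff_const)
    (h2.fderiv_apply ℝ (EuclideanSpace.single k 1))
    ((tsupport_fderiv_apply_subset ℝ (EuclideanSpace.single k 1)).trans h3)
  have e2 := hw.2.2 _ (hd.clm_apply contDiff_const)
    (h2.fderiv_apply ℝ (EuclideanSpace.single j 1))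
    ((tsupport_fderiv_apply_subset ℝ (EuclideanSpace.single j 1)).trans h3)
  simp_rw [hs] at e1 e2
  simp_rw [hsymm _ (EuclideanSpace.single k 1)] at e1
  rw [← neg_inj, ← e1, ← e2]

/-- Weak second derivatives commute. -/
lemma swap {d : EuclideanSpace ℝ (Fin n) → ℝ} (hv : HasWeakPartial Ω j u v)
    (hw : HasWeakPartial Ω k u w) (hd : HasWeakPartial Ω k v d) : HasWeakPartial Ω j w d := by
  refine ⟨hw.2.1, hd.2.1, fun φ h1 h2 h3 => ?_⟩
  rw [← hv.integral_mul_fderiv_comm hw h1 h2 h3, hd.2.2 φ h1 h2 h3]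

/-- When the ball lies in Ω, y ↦ `mollifier i (x - y)` is an admissible test function. The sign from
differentiating in y cancels the one from integration by parts. -/
lemma fderiv_mollify_indicator (hΩ : MeasurableSet Ω) (h : HasWeakPartial Ω j u v)
    (hu : LocallyIntegrable (Ω.indicator u)) (i : ℕ) {x : EuclideanSpace ℝ (Fin n)}
    (hx : Metric.closedBall x (shrinkingBump (EuclideanSpace ℝ (Fin n)) i).rOut ⊆ Ω) :
    fderiv ℝ (mollify i (Ω.indicator u)) x (EuclideanSpace.single j 1) =
      mollify i (Ω.indicator v) x := by
  have key (f g : EuclideanSpace ℝ (Fin n) → ℝ) :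
      ∫ y, Ω.indicator f y * g y = ∫ y in Ω, f y * g y := by
    rw [← integral_indicator hΩ]
    refine integral_congr_ae (Eventually.of_forall fun y => ?_)
    by_cases hy : y ∈ Ω <;> simp [hy]
  have hder (y e) : fderiv ℝ (fun y => mollifier i (x - y)) y e =
      - fderiv ℝ (mollifier i) (x - y) e := by
    have h1 : HasFDerivAt (fun y => x - y)
        (-ContinuousLinearMap.id ℝ (EuclideanSpace ℝ (Fin n))) y := (hasFDerivAt_id y).const_sub x
    have h2 := (((mollifier_contDiff (E := EuclideanSpace ℝ (Fin n)) i).differentiable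
      (by simp)) (x - y)).hasFDerivAt.comp y h1
    change fderiv ℝ (mollifier i ∘ fun y => x - y) y e = _
    rw [h2.fderiv]
    simp
  have e := h.2.2 (fun y => mollifier i (x - y))
    ((mollifier_contDiff i).comp (contDiff_const.sub contDiff_id))
    ((mollifier_hasCompactSupport i).comp_homeomorph (Homeomorph.subLeft x)) ?_
  · simp_rw [hder, mul_neg] at e
    rw [integral_neg, neg_inj] at e
    rw [fderiv_mollify_apply i hu, key, e, ← key]
    simp [mollify, mul_comm]
  · refine Subset.trans (fun y hy => ?_) hx
    have := tsupport_comp_subset_preimage (mollifier i) (f := fun y => x - y) (by fun_prop) hy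
    rw [mem_preimage, tsupport_mollifier, mem_closedBall_zero_iff] at this
    rwa [Metric.mem_closedBall, dist_comm, dist_eq_norm]

/-- At scales below r / 2 the mollifications have zero gradient on the half ball, so they are
constant there, and they converge to u almost everywhere. -/
lemma exists_ball_ae_eq_const (hΩ : IsOpen Ω) (h : ∀ j, HasWeakPartial Ω j u 0)
    (hu : LocallyIntegrableOn u Ω volume)
    {x : EuclideanSpace ℝ (Fin n)} (hx : x ∈ Ω) : ∃ r > 0, ∃ c : ℝ,
      ∀ᵐ y, y ∈ Metric.ball x r → u y = c := by
  obtain ⟨r, hr, hrΩ⟩ := Metric.nhds_basis_closedBall.mem_iff.1 (hΩ.mem_nhds hx)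
  set B := Metric.ball x r with hB
  have hBΩ : B ⊆ Ω := Metric.ball_subset_closedBall.trans hrΩ
  have hint : LocallyIntegrable (B.indicator u) := by
    refine Integrable.locallyIntegrable ?_
    rw [integrable_indicator_iff Metric.isOpen_ball.measurableSet]
    exact (hu.integrableOn_compact_subset hrΩ (isCompact_closedBall x r)).mono_set
      Metric.ball_subset_closedBall
  obtain ⟨N, hN⟩ := eventually_atTop.1
    (tendsto_shrinkingBump_rOut (E := EuclideanSpace ℝ (Fin n)) |>.eventually
      (gt_mem_nhds (half_pos hr)))
  have hconst (i : ℕ) (hi : N ≤ i) {y} (hy : y ∈ Metric.ball x (r / 2)) :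
      mollify i (B.indicator u) y = mollify i (B.indicator u) x := by
    refine Metric.isOpen_ball.is_const_of_fderiv_eq_zero (𝕜 := ℝ)
      (convex_ball x (r / 2)).isPreconnected
      ((contDiff_mollify i hint).differentiable (by simp)).differentiableOn (fun z hz => ?_) hy
      (Metric.mem_ball_self (half_pos hr))
    have hz' : Metric.closedBall z (shrinkingBump (EuclideanSpace ℝ (Fin n)) i).rOut ⊆ B := by
      refine Metric.closedBall_subset_ball' ?_
      have h1 := hN i hi
      have h2 := Metric.mem_ball.1 hz
      linarith
    refine ContinuousLinearMap.coe_injective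
      ((EuclideanSpace.basisFun (Fin n) ℝ).toBasis.ext fun j => ?_)
    have := ((h j).mono hBΩ).fderiv_mollify_indicator Metric.isOpen_ball.measurableSet hint i hz'
    simpa [mollify] using this
  have hae : ∀ᵐ y, y ∈ Metric.ball x (r / 2) →
      Tendsto (fun i => mollify i (B.indicator u) x) atTop (𝓝 (u y)) := by
    filter_upwards [ae_tendsto_mollify hint] with y hy hyB
    have hyB' : y ∈ B := Metric.ball_subset_ball (by linarith) hyB
    rw [indicator_of_mem hyB'] at hy
    refine hy.congr' ?_
    filter_upwards [eventually_ge_atTop N] with i hi using hconst i hi hyB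
  -- Convergence at the centre need not be proved separately: every good point y supplies it, with
  -- limit u y.
  refine ⟨r / 2, half_pos hr, limUnder atTop (fun i => mollify i (B.indicator u) x), ?_⟩
  filter_upwards [hae] with y hy hyB
  exact (hy hyB).limUnder_eq.symm

/-- A function on a connected open set with zero weak gradient is constant. -/
lemma ae_eq_const (hΩ : IsOpen Ω) (hc : IsConnected Ω) (h : ∀ j, HasWeakPartial Ω j u 0)
    (hu : LocallyIntegrableOn u Ω volume) : ∃ c : ℝ, ∀ᵐ x ∂(volume.restrict Ω), u x = c := by
  choose! r hr c hrc using fun x (hx : x ∈ Ω) => exists_ball_ae_eq_const hΩ h hu hx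
  obtain ⟨x₀, hx₀⟩ := hc.nonempty
  have hcc : ∀ x ∈ Ω, c x = c x₀ := by
    intro x hx
    refine hc.isPreconnected.induction₂ (fun x y => c x = c y) (fun x hx => ?_)
      (fun _ _ _ _ _ _ h1 h2 => h1.trans h2) (fun _ _ _ _ h => h.symm) hx hx₀
    filter_upwards [mem_nhdsWithin_of_mem_nhds (Metric.ball_mem_nhds x (hr x hx)),
      self_mem_nhdsWithin] with y hy hyΩ
    -- Overlapping balls carry the same constant: their nonempty open intersection meets the dense
    -- set where both identities hold.
    have hopen : IsOpen (Metric.ball x (r x) ∩ Metric.ball y (r y)) :=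
      Metric.isOpen_ball.inter Metric.isOpen_ball
    obtain ⟨z, ⟨hzx, hzy⟩, h1, h2⟩ :=
      (Measure.dense_of_ae ((hrc x hx).and (hrc y hyΩ))).inter_open_nonempty _ hopen
        ⟨y, hy, Metric.mem_ball_self (hr y hyΩ)⟩
    rw [← h1 hzx, ← h2 hzy]
  refine ⟨c x₀, (ae_restrict_iff' hΩ.measurableSet).2 ?_⟩
  refine measure_null_of_locally_null _ fun x hx => ?_
  have hxΩ : x ∈ Ω := by
    by_contra h
    exact hx fun h' => absurd h' h
  refine ⟨Metric.ball x (r x) ∩ {y | y ∈ Ω → u y = c x₀}ᶜ, inter_mem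
    (mem_nhdsWithin_of_mem_nhds (Metric.ball_mem_nhds x (hr x hxΩ))) self_mem_nhdsWithin, ?_⟩
  refine measure_mono_null (fun y hy => ?_) (ae_iff.1 (hrc x hxΩ))
  refine fun h => hy.2 fun _ => ?_
  rw [h hy.1, hcc x hxΩ]

end HasWeakPartial

end WeakDerivative

/-! ### Smooth functions of bounded Sobolev fields -/

lemma ContinuousLinearMap.sum_apply_single_mul {ι : Type*} [Fintype ι] [DecidableEq ι]
    (L : (ι → ℝ) →L[ℝ] ℝ) (v : ι → ℝ) : ∑ i, L (Pi.single i 1) * v i = L v := by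
  conv_rhs => rw [pi_eq_sum_univ' v]
  rw [map_sum]
  refine Finset.sum_congr rfl fun i _ => ?_
  rw [map_smul, smul_eq_mul, mul_comm]

section Composition

variable {X ι : Type*} [MeasurableSpace X] {μ : Measure X} {f : ι → X → ℝ} {M : ℝ}

lemma exists_ae_bound_comp [Countable ι] (hb : ∀ i, ∀ᵐ x ∂μ, |f i x| ≤ M) {G : (ι → ℝ) → ℝ}
    (hG : Continuous G) : ∃ C, ∀ᵐ x ∂μ, ‖G (fun i => f i x)‖ ≤ C := by
  obtain ⟨C, hC⟩ := (isCompact_univ_pi fun _ : ι => isCompact_Icc (a := -M) (b := M))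
    |>.exists_bound_of_continuousOn hG.continuousOn
  refine ⟨C, ?_⟩
  filter_upwards [ae_all_iff.2 hb] with x hx
  exact hC _ fun i _ => abs_le.1 (hx i)

lemma aestronglyMeasurable_comp [Finite ι] (hf : ∀ i, AEStronglyMeasurable (f i) μ)
    {G : (ι → ℝ) → ℝ} (hG : Continuous G) :
    AEStronglyMeasurable (fun x => G (fun i => f i x)) μ := by
  have := Fintype.ofFinite ι
  exact hG.comp_aestronglyMeasurable
    (aemeasurable_pi_lambda _ fun i => (hf i).aemeasurable).aestronglyMeasurable

end Composition

section ChainRule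

variable {E : Type*} [NormedAddCommGroup E] [InnerProductSpace ℝ E] [FiniteDimensional ℝ E]
  [MeasurableSpace E] [BorelSpace E] {ι : Type*} {f : ι → E → ℝ} {M : ℝ}

/-- Averaging against a probability density keeps the values in the cube [-M, M]^ι, so one constant
serves all scales. -/
lemma exists_bound_comp_mollify (hb : ∀ i, ∀ᵐ x, |f i x| ≤ M) {G : (ι → ℝ) → ℝ}
    (hG : Continuous G) : ∃ C, ∀ k x, |G (fun i => mollify k (f i) x)| ≤ C := by
  obtain ⟨C, hC⟩ := (isCompact_univ_pi fun _ : ι => isCompact_Icc (a := -M) (b := M))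
    |>.exists_bound_of_continuousOn hG.continuousOn
  exact ⟨C, fun k x => hC _ fun i _ => abs_le.1 (abs_mollify_le k (hb i) x)⟩

lemma continuous_comp_mollify (hf : ∀ i, LocallyIntegrable (f i)) {G : (ι → ℝ) → ℝ}
    (hG : Continuous G) (k : ℕ) : Continuous fun x => G (fun i => mollify k (f i) x) :=
  hG.comp (continuous_pi fun i => (contDiff_mollify k (hf i)).continuous)

lemma tendsto_integral_mul_comp_mollify [Finite ι] (hf : ∀ i, LocallyIntegrable (f i))
    (hb : ∀ i, ∀ᵐ x, |f i x| ≤ M) {G : (ι → ℝ) → ℝ} (hG : Continuous G) {g : E → ℝ}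
    (hg : Integrable g) :
    Tendsto (fun k => ∫ x, g x * G (fun i => mollify k (f i) x)) atTop
      (𝓝 (∫ x, g x * G (fun i => f i x))) := by
  obtain ⟨C, hC⟩ := exists_bound_comp_mollify hb hG
  refine tendsto_integral_of_dominated_convergence (fun x => ‖g x‖ * C) (fun k =>
    hg.1.mul (continuous_comp_mollify hf hG k).aestronglyMeasurable) (hg.norm.mul_const C)
    (fun k => Eventually.of_forall fun x => ?_) ?_
  · rw [norm_mul]
    exact mul_le_mul_of_nonneg_left (hC k x) (norm_nonneg _)
  · filter_upwards [ae_all_iff.2 fun i => ae_tendsto_mollify (hf i)] with x hx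
    exact (((hG.tendsto _).comp (tendsto_pi_nhds.2 hx))).const_mul _

/-- Split `mollify k v` as v plus an error. Dominated convergence handles v, and the error
contributes at most C times the weighted L¹ error. Integrability is only eventual, as the remainder
is known to be integrable once that quantity is finite. -/
lemma tendsto_integral_mul_comp_mollify_mul_mollify [Finite ι] {p q : ENNReal} [p.HolderConjugate q]
    (hq : 1 ≤ q) (hq' : q ≠ ⊤) (hf : ∀ i, LocallyIntegrable (f i))
    (hb : ∀ i, ∀ᵐ x, |f i x| ≤ M) {G : (ι → ℝ) → ℝ} (hG : Continuous G) {w v : E → ℝ}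
    (hw : MemLp w p) (hv : MemLp v q) :
    (∀ᶠ k in atTop, Integrable fun x => w x * (G (fun i => mollify k (f i) x) * mollify k v x)) ∧
    Tendsto (fun k => ∫ x, w x * (G (fun i => mollify k (f i) x) * mollify k v x)) atTop
      (𝓝 (∫ x, w x * (G (fun i => f i x) * v x))) := by
  obtain ⟨C, hC⟩ := exists_bound_comp_mollify hb hG
  have hvl : LocallyIntegrable v := hv.locallyIntegrable hq
  have hwv : Integrable fun x => w x * v x := memLp_one_iff_integrable.1 (hv.mul' hw)
  have hcont (k : ℕ) := (continuous_comp_mollify hf hG k)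
  have hmain := tendsto_integral_mul_comp_mollify hf hb hG hwv
  set r : ℕ → E → ℝ := fun k x =>
    w x * (G (fun i => mollify k (f i) x) * (mollify k v x - v x)) with hr
  have hrm (k : ℕ) : AEStronglyMeasurable (r k) volume :=
    hw.1.mul ((hcont k).aestronglyMeasurable.mul
      ((contDiff_mollify k hvl).continuous.aestronglyMeasurable.sub hv.1))
  have hrl : Tendsto (fun k => ∫⁻ x, ‖r k x‖ₑ) atTop (𝓝 0) := by
    have h0 := ENNReal.Tendsto.const_mul (a := ENNReal.ofReal C)
      (tendsto_lintegral_mul_mollify_sub hq hq' hw hv) (Or.inr ENNReal.ofReal_ne_top)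
    rw [mul_zero] at h0
    refine tendsto_of_tendsto_of_tendsto_of_le_of_le tendsto_const_nhds h0 (fun _ => zero_le)
      fun k => ?_
    simp only
    rw [← lintegral_const_mul' _ _ ENNReal.ofReal_ne_top]
    refine lintegral_mono fun x => ?_
    simp only [hr, enorm_mul]
    rw [mul_left_comm]
    gcongr
    rw [← ofReal_norm]
    exact ENNReal.ofReal_le_ofReal (hC k x)
  have hri : ∀ᶠ k in atTop, Integrable (r k) := by
    filter_upwards [hrl.eventually (gt_mem_nhds ENNReal.zero_lt_top)] with k hk
    exact ⟨hrm k, hk⟩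
  have hgi (k : ℕ) : Integrable fun x => w x * v x * G (fun i => mollify k (f i) x) :=
    hwv.mul_bdd (hcont k).aestronglyMeasurable (Eventually.of_forall fun x => hC k x)
  have hsum (k : ℕ) : (fun x => w x * (G (fun i => mollify k (f i) x) * mollify k v x)) =
      fun x => w x * v x * G (fun i => mollify k (f i) x) + r k x := by
    ext x
    simp only [hr]
    ring
  have hr0 : Tendsto (fun k => ∫ x, r k x) atTop (𝓝 0) := by
    rw [tendsto_iff_edist_tendsto_0]
    simp_rw [edist_zero_right]
    refine tendsto_of_tendsto_of_tendsto_of_le_of_le tendsto_const_nhds hrl (fun _ => zero_le)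
      fun k => enorm_integral_le_lintegral_enorm _
  refine ⟨?_, ?_⟩
  · filter_upwards [hri] with k hk
    rw [hsum k]
    exact (hgi k).add hk
  · have h1 := hmain.add hr0
    rw [add_zero] at h1
    have h2 : ∫ x, w x * (G (fun i => f i x) * v x) = ∫ x, w x * v x * G (fun i => f i x) :=
      integral_congr_ae (Eventually.of_forall fun x => by ring)
    rw [h2]
    refine h1.congr' ?_
    filter_upwards [hri] with k hk
    rw [hsum k, integral_add (hgi k) hk]

/-- At each scale the classical product and chain rules expand the derivative of φ H(f_k), and each
term passes to the limit. The derivatives of f_k are needed only on `tsupport φ`, everything else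
vanishing off it. -/
lemma tendsto_integral_mul_fderiv_comp_mollify [Fintype ι] {p q : ENNReal}
    [p.HolderConjugate q] (hp : 1 ≤ p) (hq : 1 ≤ q) (hq' : q ≠ ⊤)
    (hf : ∀ i, LocallyIntegrable (f i))
    (hb : ∀ i, ∀ᵐ x, |f i x| ≤ M) {H : (ι → ℝ) → ℝ} (hH : ContDiff ℝ ∞ H) {φ : E → ℝ}
    (hφ : ContDiff ℝ ∞ φ) (hφc : HasCompactSupport φ) {e : E} {d : ι → E → ℝ} {w : E → ℝ}
    (hw : MemLp w p) (hd : ∀ i, MemLp (d i) q)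
    (hder : ∀ᶠ k in atTop, ∀ x ∈ tsupport φ, ∀ i,
      fderiv ℝ (mollify k (f i)) x e = mollify k (d i) x) :
    Integrable (fun x => w x * (fderiv ℝ φ x e * H (fun i => f i x) +
        φ x * fderiv ℝ H (fun i => f i x) (fun i => d i x))) ∧
    Tendsto (fun k => ∫ x, w x * fderiv ℝ (fun y => φ y * H (fun i => mollify k (f i) y)) x e)
      atTop (𝓝 (∫ x, w x * (fderiv ℝ φ x e * H (fun i => f i x) +
        φ x * fderiv ℝ H (fun i => f i x) (fun i => d i x)))) := by
  classical
  have hexp (x : E) : fderiv ℝ H (fun i => f i x) (fun i => d i x) =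
      ∑ i, fderiv ℝ H (fun i => f i x) (Pi.single i 1) * d i x :=
    (ContinuousLinearMap.sum_apply_single_mul _ _).symm
  simp_rw [hexp]
  have hφe : Continuous fun x => fderiv ℝ φ x e :=
    (hφ.continuous_fderiv (by simp)).clm_apply continuous_const
  have hg : Integrable fun x => w x * fderiv ℝ φ x e := by
    have := (hw.locallyIntegrable hp).integrable_smul_left_of_hasCompactSupport hφe
      (hφc.fderiv_apply ℝ e)
    simpa [mul_comm] using this
  have hwφ : MemLp (fun x => w x * φ x) p := by
    obtain ⟨C, hC⟩ := hφc.exists_bound_of_continuous hφ.continuous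
    refine (hw.const_mul C).of_le (hw.1.mul hφ.continuous.aestronglyMeasurable)
      (Eventually.of_forall fun x => ?_)
    rw [norm_mul, norm_mul, mul_comm]
    exact mul_le_mul_of_nonneg_right ((hC x).trans (le_abs_self C)) (norm_nonneg _)
  have hGi (i : ι) : Continuous fun y => fderiv ℝ H y (Pi.single i 1) :=
    (hH.continuous_fderiv (by simp)).clm_apply continuous_const
  have h1 := tendsto_integral_mul_comp_mollify hf hb hH.continuous hg
  have h2 (i : ι) := tendsto_integral_mul_comp_mollify_mul_mollify hq hq' hf hb (hGi i) hwφ (hd i)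
  have h3 := h1.add (tendsto_finsetSum Finset.univ fun i _ => (h2 i).2)
  have hlim0 : Integrable fun x => w x * fderiv ℝ φ x e * H (fun i => f i x) := by
    obtain ⟨C, hC⟩ := exists_ae_bound_comp hb hH.continuous
    exact hg.mul_bdd
      (aestronglyMeasurable_comp (fun i => (hf i).aestronglyMeasurable) hH.continuous) hC
  have hlimi (i : ι) : Integrable fun x =>
      w x * φ x * (fderiv ℝ H (fun i => f i x) (Pi.single i 1) * d i x) := by
    obtain ⟨C, hC⟩ := exists_ae_bound_comp hb (hGi i)
    have h5 : Integrable fun x => w x * φ x * d i x :=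
      memLp_one_iff_integrable.1 ((hd i).mul' hwφ)
    refine (h5.mul_bdd (aestronglyMeasurable_comp (fun i => (hf i).aestronglyMeasurable) (hGi i))
      hC).congr (Eventually.of_forall fun x => ?_)
    simp only
    ring
  have hlim : ∫ x, w x * (fderiv ℝ φ x e * H (fun i => f i x) +
        φ x * ∑ i, fderiv ℝ H (fun i => f i x) (Pi.single i 1) * d i x) =
      (∫ x, w x * fderiv ℝ φ x e * H (fun i => f i x)) +
        ∑ i, ∫ x, w x * φ x * (fderiv ℝ H (fun i => f i x) (Pi.single i 1) * d i x) := by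
    rw [← integral_finsetSum _ fun i _ => hlimi i, ← integral_add hlim0
      (integrable_finsetSum _ fun i _ => hlimi i)]
    refine integral_congr_ae (Eventually.of_forall fun x => ?_)
    simp only [← Finset.mul_sum]
    ring
  refine ⟨(hlim0.add (integrable_finsetSum Finset.univ fun i _ => hlimi i)).congr
    (Eventually.of_forall fun x => ?_), ?_⟩
  · simp only [Pi.add_apply, ← Finset.mul_sum]
    ring
  rw [hlim]
  refine h3.congr' ?_
  filter_upwards [hder, eventually_all.2 fun i => (h2 i).1] with k hk hki
  rw [← integral_finsetSum _ fun i _ => hki i, ← integral_add]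
  · refine integral_congr_ae (Eventually.of_forall fun x => ?_)
    by_cases hx : x ∈ tsupport φ
    · have hfd : HasFDerivAt (fun y => fun i => mollify k (f i) y)
          (ContinuousLinearMap.pi fun i => fderiv ℝ (mollify k (f i)) x) x :=
        hasFDerivAt_pi.2 fun i =>
          ((contDiff_mollify k (hf i)).differentiable (by simp) x).hasFDerivAt
      have hcomp := ((hH.differentiable (by simp) _).hasFDerivAt).comp x hfd
      have hprod := ((hφ.differentiable (by simp) x).hasFDerivAt).mul hcomp
      have hexp := (fderiv ℝ H (fun i => mollify k (f i) x)).sum_apply_single_mul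
        (fun i => mollify k (d i) x)
      have : fderiv ℝ (fun y => φ y * H (fun i => mollify k (f i) y)) x e =
          φ x * fderiv ℝ H (fun i => mollify k (f i) x) (fun i => mollify k (d i) x) +
          H (fun i => mollify k (f i) x) * fderiv ℝ φ x e := by
        change fderiv ℝ (φ * H ∘ fun y => fun i => mollify k (f i) y) x e = _
        rw [hprod.fderiv]
        simp only [_root_.add_apply, _root_.smul_apply,
          ContinuousLinearMap.comp_apply, smul_eq_mul, Function.comp_apply]
        congr 3
        ext i
        exact hk x hx i
      simp only [this, ← hexp, ← Finset.mul_sum]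
      ring
    · have h0 : fderiv ℝ φ x = 0 := by
        by_contra h
        exact hx (support_fderiv_subset ℝ h)
      have h0' : fderiv ℝ (fun y => φ y * H (fun i => mollify k (f i) y)) x = 0 := by
        by_contra h
        exact hx (tsupport_mul_subset_left (support_fderiv_subset ℝ h))
      simp [h0, h0', image_eq_zero_of_notMem_tsupport hx]
  · obtain ⟨C, hC⟩ := exists_bound_comp_mollify hb hH.continuous
    exact hg.mul_bdd (continuous_comp_mollify hf hH.continuous k).aestronglyMeasurable
      (Eventually.of_forall fun x => hC k x)
  · exact integrable_finsetSum _ fun i _ => hki i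

end ChainRule

/-! ### Curl-freeness tested against nonsmooth functions -/

section CurlFree

variable {n : ℕ} {Ω : Set (EuclideanSpace ℝ (Fin n))} {j k : Fin n}
  {u v w : EuclideanSpace ℝ (Fin n) → ℝ} {ι : Type*} [Fintype ι]
  {F Dj Dk : ι → EuclideanSpace ℝ (Fin n) → ℝ} {M : ℝ} {p q : ENNReal}

lemma eventually_closedBall_shrinkingBump_subset (hΩ : IsOpen Ω)
    {K : Set (EuclideanSpace ℝ (Fin n))} (hK : IsCompact K) (hKΩ : K ⊆ Ω) :
    ∀ᶠ i in atTop, ∀ x ∈ K,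
      Metric.closedBall x (shrinkingBump (EuclideanSpace ℝ (Fin n)) i).rOut ⊆ Ω := by
  obtain ⟨δ, hδ, hsub⟩ := hK.exists_cthickening_subset_open hΩ hKΩ
  filter_upwards [(tendsto_shrinkingBump_rOut (E := EuclideanSpace ℝ (Fin n))).eventually
    (gt_mem_nhds hδ)] with i hi x hx
  exact (Metric.closedBall_subset_closedBall hi.le).trans
    ((Metric.closedBall_subset_cthickening hx δ).trans hsub)

/-- The curl-freeness of a weak gradient in `L^p`, tested against `φ * H ∘ F` for a bounded
field `F` with weak derivatives in `L^q` and a smooth function `H`. -/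
lemma HasWeakPartial.integral_mul_comp_comm [p.HolderConjugate q] (hp : 1 ≤ p) (hq : 1 ≤ q)
    (hq' : q ≠ ⊤) (hΩ : IsOpen Ω) (hv : HasWeakPartial Ω j u v) (hw : HasWeakPartial Ω k u w)
    (hvp : MemLp v p (volume.restrict Ω)) (hwp : MemLp w p (volume.restrict Ω))
    (hFj : ∀ i, HasWeakPartial Ω j (F i) (Dj i)) (hFk : ∀ i, HasWeakPartial Ω k (F i) (Dk i))
    (hDj : ∀ i, MemLp (Dj i) q (volume.restrict Ω))
    (hDk : ∀ i, MemLp (Dk i) q (volume.restrict Ω)) (hM : 0 ≤ M)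
    (hF : ∀ i, ∀ᵐ x ∂(volume.restrict Ω), |F i x| ≤ M)
    {H : (ι → ℝ) → ℝ} (hH : ContDiff ℝ ∞ H) {φ : EuclideanSpace ℝ (Fin n) → ℝ}
    (hφ : ContDiff ℝ ∞ φ) (hφc : HasCompactSupport φ) (hφΩ : tsupport φ ⊆ Ω) :
    IntegrableOn (fun x => v x * (fderiv ℝ φ x (EuclideanSpace.single k 1) * H (fun i => F i x) +
        φ x * fderiv ℝ H (fun i => F i x) (fun i => Dk i x))) Ω ∧
    IntegrableOn (fun x => w x * (fderiv ℝ φ x (EuclideanSpace.single j 1) * H (fun i => F i x) +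
        φ x * fderiv ℝ H (fun i => F i x) (fun i => Dj i x))) Ω ∧
    ∫ x in Ω, v x * (fderiv ℝ φ x (EuclideanSpace.single k 1) * H (fun i => F i x) +
        φ x * fderiv ℝ H (fun i => F i x) (fun i => Dk i x)) =
      ∫ x in Ω, w x * (fderiv ℝ φ x (EuclideanSpace.single j 1) * H (fun i => F i x) +
        φ x * fderiv ℝ H (fun i => F i x) (fun i => Dj i x)) := by
  have hm := hΩ.measurableSet
  set f : ι → EuclideanSpace ℝ (Fin n) → ℝ := fun i => Ω.indicator (F i) with hfdef
  have hb (i) : ∀ᵐ x, |f i x| ≤ M := by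
    filter_upwards [(ae_restrict_iff' hm).1 (hF i)] with x hx
    by_cases h : x ∈ Ω
    · simpa [hfdef, h] using hx h
    · simpa [hfdef, h] using hM
  have hf (i) : LocallyIntegrable (f i) := by
    have : MemLp (f i) ⊤ := memLp_top_of_bound
      ((aestronglyMeasurable_indicator_iff hm).2 ((hFj i).1.aestronglyMeasurable)) M (hb i)
    exact this.locallyIntegrable le_top
  have hball := eventually_closedBall_shrinkingBump_subset hΩ hφc hφΩ
  have hlim {l : Fin n} {g : EuclideanSpace ℝ (Fin n) → ℝ}
      {D : ι → EuclideanSpace ℝ (Fin n) → ℝ} (hg : MemLp g p (volume.restrict Ω))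
      (hFl : ∀ i, HasWeakPartial Ω l (F i) (D i)) (hD : ∀ i, MemLp (D i) q (volume.restrict Ω)) :
      IntegrableOn (fun x => g x * (fderiv ℝ φ x (EuclideanSpace.single l 1) *
        H (fun i => F i x) + φ x * fderiv ℝ H (fun i => F i x) (fun i => D i x))) Ω ∧
      Tendsto (fun a => ∫ x in Ω, g x *
          fderiv ℝ (fun y => φ y * H (fun i => mollify a (f i) y)) x (EuclideanSpace.single l 1))
        atTop (𝓝 (∫ x in Ω, g x * (fderiv ℝ φ x (EuclideanSpace.single l 1) *
          H (fun i => F i x) + φ x * fderiv ℝ H (fun i => F i x) (fun i => D i x)))) := by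
    have h := tendsto_integral_mul_fderiv_comp_mollify (p := p) (q := q) hp hq hq' hf hb hH hφ hφc
      (e := EuclideanSpace.single l 1) (d := fun i => Ω.indicator (D i)) (w := Ω.indicator g)
      ((memLp_indicator_iff_restrict hm).2 hg)
      (fun i => (memLp_indicator_iff_restrict hm).2 (hD i)) ?_
    · have e1 : ∀ G : EuclideanSpace ℝ (Fin n) → ℝ,
          ∫ x, Ω.indicator g x * G x = ∫ x in Ω, g x * G x := fun G => by
        rw [← integral_indicator hm]
        refine integral_congr_ae (Eventually.of_forall fun x => ?_)
        by_cases hx : x ∈ Ω <;> simp [hx]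
      simp_rw [e1] at h
      refine ⟨(integrable_indicator_iff hm).1 (h.1.congr (Eventually.of_forall fun x => ?_)), ?_⟩
      · by_cases hx : x ∈ Ω <;> simp [hfdef, hx]
      convert h.2 using 2
      refine setIntegral_congr_fun hm fun x hx => ?_
      simp [hfdef, hx]
    · filter_upwards [hball] with a ha x hx i
      exact (hFl i).fderiv_mollify_indicator hm (hf i) a (ha x hx)
  refine ⟨(hlim hvp hFk hDk).1, (hlim hwp hFj hDj).1,
    tendsto_nhds_unique (hlim hvp hFk hDk).2 ((hlim hwp hFj hDj).2.congr fun a => ?_)⟩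
  -- At a fixed scale φ H(f_a) is a genuine smooth test function, so the two approximating integrals
  -- agree exactly.
  refine (hv.integral_mul_fderiv_comm hw ?_ hφc.mul_right ?_).symm
  · exact hφ.mul (hH.comp (contDiff_pi.2 fun i => contDiff_mollify a (hf i)))
  · exact (tsupport_mul_subset_left).trans hφΩ

end CurlFree

/-! ### Pointwise algebra of axial vectors and curls -/

/-- A smooth function which agrees with `t ↦ t⁻¹` on `[c, ∞)`. -/
noncomputable def cutoffInv (c t : ℝ) : ℝ := Real.smoothTransition (2 * t / c - 1) * t⁻¹

lemma cutoffInv_of_le {c t : ℝ} (hc : 0 < c) (h : c ≤ t) : cutoffInv c t = t⁻¹ := by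
  rw [cutoffInv, Real.smoothTransition.one_of_one_le, one_mul]
  have : 1 ≤ t / c := (one_le_div hc).2 h
  rw [mul_div_assoc]
  linarith

/-- The function vanishes below c / 2 and is smooth away from 0. Smoothness on all of ℝ matters
because the determinant of a mollified F may take values near 0. -/
lemma contDiff_cutoffInv {c : ℝ} (hc : 0 < c) : ContDiff ℝ ∞ (cutoffInv c) := by
  rw [contDiff_iff_contDiffAt]
  intro t
  by_cases ht : t < c / 2
  · have : cutoffInv c =ᶠ[𝓝 t] fun _ => 0 := by
      filter_upwards [gt_mem_nhds ht] with s hs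
      rw [cutoffInv, Real.smoothTransition.zero_of_nonpos, zero_mul]
      rw [sub_nonpos, div_le_one hc]
      linarith
    exact contDiffAt_const.congr_of_eventuallyEq this
  · have ht0 : t ≠ 0 := by
      have := half_pos hc
      intro h
      exact ht (h ▸ this)
    have h1 : ContDiff ℝ ∞ fun t : ℝ => Real.smoothTransition (2 * t / c - 1) :=
      Real.smoothTransition.contDiff.comp
        (((contDiff_const.mul contDiff_id).div_const c).sub contDiff_const)
    exact h1.contDiffAt.mul (contDiffAt_inv ℝ ht0)

/-- The determinant of a `3 × 3` matrix, as a function of its family of entries. -/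
def entriesDet (M : Fin 3 × Fin 3 → ℝ) : ℝ := (Matrix.of fun i j => M (i, j)).det

lemma contDiff_entriesDet : ContDiff ℝ ∞ entriesDet := by
  unfold entriesDet
  simp only [Matrix.det_fin_three, Matrix.of_apply]
  fun_prop

/-- The `j`-th column of the matrix `M` multiplied by the skew matrix with axial vector `a`. -/
def axialMul (a : Fin 3 → ℝ) (M : Fin 3 × Fin 3 → ℝ) (i j : Fin 3) : ℝ :=
  a (i + 1) * M (i + 2, j) - a (i + 2) * M (i + 1, j)

/-- Coefficients which isolate the `l`-th derivative of the `m`-th component of the axial vector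
from the curl of `axialMul`, wherever `cutoffInv c` inverts the determinant. -/
noncomputable def curlMultiplier (c : ℝ) (m l : Fin 3) (i r : Fin 3) (M : Fin 3 × Fin 3 → ℝ) : ℝ :=
  cutoffInv c (entriesDet M) * (M (i, l) * M (m, r) - M (m, l) * M (i, r) / 2)

lemma contDiff_curlMultiplier {c : ℝ} (hc : 0 < c) (m l i r : Fin 3) :
    ContDiff ℝ ∞ (curlMultiplier c m l i r) := by
  have h1 := (contDiff_cutoffInv hc).comp contDiff_entriesDet
  refine h1.mul ?_
  fun_prop

/-- Put g = Mᵀγ. Pairing row i of a × M, crossed with g, with row m of M gives det M (a_m γ_i - δ_im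
a·γ). Contracting with M(i, l) gives det M (a_m g_l - M(m, l) a·γ). The trace over i = m is -2 det M
(a·γ), so the term with factor 1/2 removes the unwanted part. -/
lemma sum_axialMul_mul_curlMultiplier {c : ℝ} (m l : Fin 3) (a g : Fin 3 → ℝ)
    {M : Fin 3 × Fin 3 → ℝ} (hM : entriesDet M * cutoffInv c (entriesDet M) = 1) :
    ∑ i, ∑ r, (axialMul a M i (r + 1) * g (r + 2) - axialMul a M i (r + 2) * g (r + 1)) *
      curlMultiplier c m l i r M = a m * g l := by
  unfold curlMultiplier axialMul
  generalize cutoffInv c (entriesDet M) = d at hM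
  simp only [entriesDet, Matrix.det_fin_three, Matrix.of_apply] at hM
  have e1 : (1 : Fin 3) + 1 = 2 := rfl
  have e2 : (1 : Fin 3) + 2 = 0 := rfl
  have e3 : (2 : Fin 3) + 1 = 0 := rfl
  have e4 : (2 : Fin 3) + 2 = 1 := rfl
  simp only [Fin.sum_univ_three, zero_add, e1, e2, e3, e4]
  fin_cases m <;> fin_cases l <;>
    simp only [Fin.zero_eta, Fin.mk_one, Fin.reduceFinMk] <;>
  [linear_combination (a 0 * g 0) * hM; linear_combination (a 0 * g 1) * hM;
    linear_combination (a 0 * g 2) * hM; linear_combination (a 1 * g 0) * hM;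
    linear_combination (a 1 * g 1) * hM; linear_combination (a 1 * g 2) * hM;
    linear_combination (a 2 * g 0) * hM; linear_combination (a 2 * g 1) * hM;
    linear_combination (a 2 * g 2) * hM]

/-- This is the derivative in direction V of the preceding identity, whose right side does not
depend on M. The strict inequality keeps the identity valid near M. -/
lemma sum_axialMul_mul_fderiv_curlMultiplier {c : ℝ} (hc : 0 < c) (m l : Fin 3) (a g : Fin 3 → ℝ)
    {M : Fin 3 × Fin 3 → ℝ} (hM : c < entriesDet M) (V : Fin 3 × Fin 3 → ℝ) :
    ∑ i, ∑ r, ((axialMul a V i (r + 1) * g (r + 2) - axialMul a V i (r + 2) * g (r + 1)) *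
        curlMultiplier c m l i r M +
      (axialMul a M i (r + 1) * g (r + 2) - axialMul a M i (r + 2) * g (r + 1)) *
        fderiv ℝ (curlMultiplier c m l i r) M V) = 0 := by
  have hline : HasDerivAt (fun t : ℝ => M + t • V) V 0 := by
    simpa using ((hasDerivAt_id (0 : ℝ)).smul_const V).const_add M
  have hax (i j : Fin 3) : HasDerivAt (fun t : ℝ => axialMul a (M + t • V) i j)
      (axialMul a V i j) 0 := by
    have h1 : (fun t : ℝ => axialMul a (M + t • V) i j) =
        fun t => axialMul a M i j + t * axialMul a V i j := by
      ext t
      simp only [axialMul, Pi.add_apply, Pi.smul_apply, smul_eq_mul]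
      ring
    rw [h1]
    simpa using ((hasDerivAt_id (0 : ℝ)).mul_const (axialMul a V i j)).const_add (axialMul a M i j)
  have hcurl (i r : Fin 3) : HasDerivAt (fun t : ℝ => curlMultiplier c m l i r (M + t • V))
      (fderiv ℝ (curlMultiplier c m l i r) M V) 0 := by
    have h1 : HasFDerivAt (curlMultiplier c m l i r) (fderiv ℝ (curlMultiplier c m l i r) M)
        (M + (0 : ℝ) • V) := by
      simpa using ((contDiff_curlMultiplier hc m l i r).differentiable (by simp) M).hasFDerivAt
    exact h1.comp_hasDerivAt 0 hline
  have hsum := HasDerivAt.fun_sum (u := Finset.univ) fun i _ =>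
    HasDerivAt.fun_sum (u := Finset.univ) fun r _ =>
      ((((hax i (r + 1)).mul_const (g (r + 2))).sub ((hax i (r + 2)).mul_const (g (r + 1)))).mul
        (hcurl i r))
  have hev : (fun _ : ℝ => a m * g l) =ᶠ[𝓝 0] fun t => ∑ i, ∑ r,
      (axialMul a (M + t • V) i (r + 1) * g (r + 2) -
        axialMul a (M + t • V) i (r + 2) * g (r + 1)) * curlMultiplier c m l i r (M + t • V) := by
    have hcont : ContinuousAt (fun t : ℝ => entriesDet (M + t • V)) 0 :=
      (contDiff_entriesDet.continuous.comp (by fun_prop)).continuousAt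
    have h0 : c < entriesDet (M + (0 : ℝ) • V) := by simpa using hM
    filter_upwards [hcont.eventually (lt_mem_nhds h0)] with t ht
    rw [sum_axialMul_mul_curlMultiplier]
    rw [cutoffInv_of_le hc ht.le, mul_inv_cancel₀ (hc.trans ht).ne']
  have h0 := (hsum.congr_of_eventuallyEq hev).unique (hasDerivAt_const 0 _)
  simpa using h0

/-- Apply the differentiated identity with g = e_k, V = D k and sum over k. The terms with `axialMul
a (D k)` form the curl of a × M at frozen a and cancel by symmetry of D; what remains says that the
terms with factor s vanish. -/
lemma sum_axialMul_mul_curl {c : ℝ} (hc : 0 < c) (m l : Fin 3) (a g : Fin 3 → ℝ) (s : ℝ)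
    {M : Fin 3 × Fin 3 → ℝ} (hM : c < entriesDet M) {D : Fin 3 → Fin 3 × Fin 3 → ℝ}
    (hD : ∀ i j k, D k (i, j) = D j (i, k)) :
    ∑ i, ∑ r, (axialMul a M i (r + 1) * (g (r + 2) * curlMultiplier c m l i r M +
        s * fderiv ℝ (curlMultiplier c m l i r) M (D (r + 2))) -
      axialMul a M i (r + 2) * (g (r + 1) * curlMultiplier c m l i r M +
        s * fderiv ℝ (curlMultiplier c m l i r) M (D (r + 1)))) = a m * g l := by
  have h1 := sum_axialMul_mul_curlMultiplier (c := c) m l a g (M := M) (by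
    rw [cutoffInv_of_le hc hM.le, mul_inv_cancel₀ (hc.trans hM).ne'])
  have h2 (k : Fin 3) := sum_axialMul_mul_fderiv_curlMultiplier hc m l a (Pi.single k 1) hM (D k)
  have hs (i j k : Fin 3) : axialMul a (D k) i j = axialMul a (D j) i k := by
    simp only [axialMul, hD _ j k]
  have e1 : (1 : Fin 3) + 1 = 2 := rfl
  have e2 : (1 : Fin 3) + 2 = 0 := rfl
  have e3 : (2 : Fin 3) + 1 = 0 := rfl
  have e4 : (2 : Fin 3) + 2 = 1 := rfl
  have h20 := h2 0
  have h21 := h2 1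
  have h22 := h2 2
  clear h2
  simp only [Fin.sum_univ_three, zero_add, e1, e2, e3, e4] at h1 h20 h21 h22 ⊢
  simp at h20 h21 h22
  simp only [hs _ 1 0, hs _ 2 0, hs _ 2 1] at h20 h21 h22
  linear_combination h1 + s * (h20 + h21 + h22)

/-- If `sym (Wᵀ F) = 0` with `F` invertible, then `W F⁻¹` is skew-symmetric. -/
lemma transpose_mul_eq_neg_of_symPart_eq_zero {n : ℕ} {W F G : Matrix (Fin n) (Fin n) ℝ}
    (h : symPart (Wᵀ * F) = 0) (hFG : F * G = 1) : (W * G)ᵀ = -(W * G) := by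
  have h1 : Wᵀ * F + Fᵀ * W = 0 := by
    have := (smul_eq_zero.1 h).resolve_left (by norm_num)
    simpa using this
  have h2 : Gᵀ * Fᵀ = 1 := by rw [← Matrix.transpose_mul, hFG, Matrix.transpose_one]
  rw [Matrix.transpose_mul, eq_neg_iff_add_eq_zero]
  calc Gᵀ * Wᵀ + W * G = Gᵀ * Wᵀ * (F * G) + (Gᵀ * Fᵀ) * (W * G) := by
        rw [hFG, h2, mul_one, one_mul]
    _ = Gᵀ * (Wᵀ * F + Fᵀ * W) * G := by noncomm_ring
    _ = 0 := by rw [h1]; simp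

/-- The axial vector of `W F⁻¹`, with the inverse of `det F` cut off at `c`. -/
noncomputable def axialVector (c : ℝ) (W F : Matrix (Fin 3) (Fin 3) ℝ) (i : Fin 3) : ℝ :=
  ∑ k, W (i + 2) k * (cutoffInv c F.det * F.adjugate k (i + 1))

/-- The skew matrix A = WF⁻¹ acts as the cross product with its axial vector a_i = A(i+2, i+1), and
W = AF. -/
lemma axialMul_axialVector {c : ℝ} (hc : 0 < c) {W F : Matrix (Fin 3) (Fin 3) ℝ}
    (hF : c ≤ F.det) (h : symPart (Wᵀ * F) = 0) (i j : Fin 3) :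
    axialMul (axialVector c W F) (fun b => F b.1 b.2) i j = W i j := by
  set G := F.det⁻¹ • F.adjugate with hG
  have hdet : F.det ≠ 0 := (hc.trans_le hF).ne'
  have hFG : F * G = 1 := by
    rw [hG, Matrix.mul_smul, Matrix.mul_adjugate, smul_smul, inv_mul_cancel₀ hdet, one_smul]
  have hGF : G * F = 1 := by
    rw [hG, Matrix.smul_mul, Matrix.adjugate_mul, smul_smul, inv_mul_cancel₀ hdet, one_smul]
  have hskew := transpose_mul_eq_neg_of_symPart_eq_zero h hFG
  have ha (i) : axialVector c W F i = (W * G) (i + 2) (i + 1) := by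
    simp [axialVector, cutoffInv_of_le hc hF, Matrix.mul_apply, hG]
  have hW : W i j = ∑ k, (W * G) i k * F k j := by
    rw [← Matrix.mul_apply, mul_assoc, hGF, mul_one]
  generalize W * G = A at hskew ha hW
  have hs (a b) : A a b = - A b a := by
    have := congrFun (congrFun hskew b) a
    simpa using this
  have h00 := hs 0 0
  have h11 := hs 1 1
  have h22 := hs 2 2
  have e1 : (1 : Fin 3) + 1 = 2 := rfl
  have e2 : (1 : Fin 3) + 2 = 0 := rfl
  have e3 : (2 : Fin 3) + 1 = 0 := rfl
  have e4 : (2 : Fin 3) + 2 = 1 := rfl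
  rw [hW]
  simp only [axialMul, ha, Fin.sum_univ_three]
  fin_cases i <;> simp only [Fin.zero_eta, Fin.mk_one, Fin.reduceFinMk, zero_add, e1, e2, e3, e4]
  -- Skewness on the diagonal reads A_ii = -A_ii, whence the halves.
  · linear_combination (-F 1 j) * hs 1 0 - F 0 j / 2 * h00
  · linear_combination (-F 2 j) * hs 2 1 - F 1 j / 2 * h11
  · linear_combination (-F 0 j) * hs 0 2 - F 2 j / 2 * h22

/-! ### Constancy of the axial field and conclusion -/

section Rigidity

variable {Ω : Set (EuclideanSpace ℝ (Fin 3))}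

/-- An axial field `a ∈ L^p` with `a × F` a gradient, where `F` is a bounded gradient with
derivatives in `L^q` and determinant bounded below, has zero weak gradient. -/
lemma hasWeakPartial_axial_zero {p q : ENNReal} [p.HolderConjugate q] (hp : 1 ≤ p) (hq : 1 ≤ q)
    (hq' : q ≠ ⊤) (hΩ : IsOpen Ω) {Φ : EuclideanSpace ℝ (Fin 3) → EuclideanSpace ℝ (Fin 3)}
    {W F : EuclideanSpace ℝ (Fin 3) → Matrix (Fin 3) (Fin 3) ℝ}
    {D : Fin 3 → Fin 3 × Fin 3 → EuclideanSpace ℝ (Fin 3) → ℝ}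
    {a : EuclideanSpace ℝ (Fin 3) → Fin 3 → ℝ} {c M : ℝ} (hc : 0 < c) (hM : 0 ≤ M)
    (hW : IsWeakJacobian Ω Φ W)
    (hWp : ∀ i j, MemLp (fun x => W x i j) p (volume.restrict Ω))
    (hF : ∀ b : Fin 3 × Fin 3, ∀ᵐ x ∂(volume.restrict Ω), |F x b.1 b.2| ≤ M)
    (hFD : ∀ k b, HasWeakPartial Ω k (fun x => F x b.1 b.2) (D k b))
    (hDq : ∀ k b, MemLp (D k b) q (volume.restrict Ω))
    (hD : ∀ᵐ x ∂(volume.restrict Ω), ∀ i j k, D k (i, j) x = D j (i, k) x)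
    (hdet : ∀ᵐ x ∂(volume.restrict Ω), c < (F x).det)
    (ha : ∀ m, LocallyIntegrableOn (fun x => a x m) Ω volume)
    (haW : ∀ᵐ x ∂(volume.restrict Ω), ∀ i j,
      axialMul (a x) (fun b => F x b.1 b.2) i j = W x i j) (m l : Fin 3) :
    HasWeakPartial Ω l (fun x => a x m) 0 := by
  refine ⟨ha m, locallyIntegrableOn_zero, fun φ h1 h2 h3 => ?_⟩
  -- Component r of the curl of row i of W, tested against φ times its own multiplier of F.
  have key (i r : Fin 3) := (hW i (r + 1)).integral_mul_comp_comm hp hq hq' hΩ (hW i (r + 2))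
    (hWp i (r + 1)) (hWp i (r + 2)) (hFD (r + 1)) (hFD (r + 2)) (hDq (r + 1)) (hDq (r + 2)) hM hF
    (contDiff_curlMultiplier hc m l i r) h1 h2 h3
  have hint (i r : Fin 3) := (key i r).1.sub (key i r).2.1
  have hzero := integral_finsetSum Finset.univ fun i _ =>
    integrable_finsetSum Finset.univ fun r _ => hint i r
  have hzero' : ∀ i ∈ (Finset.univ : Finset (Fin 3)), _ := fun i _ =>
    (integral_finsetSum Finset.univ fun r _ => hint i r).trans
      (Finset.sum_eq_zero fun r _ => (integral_sub (key i r).1 (key i r).2.1).trans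
        (sub_eq_zero.2 (key i r).2.2))
  rw [Finset.sum_eq_zero hzero'] at hzero
  simp only [Pi.zero_apply, zero_mul, integral_zero, neg_zero]
  rw [← hzero]
  refine integral_congr_ae ?_
  filter_upwards [hD, hdet, haW] with x hDx hdx hax
  simp only [Pi.sub_apply, ← hax]
  exact (sum_axialMul_mul_curl hc m l (a x)
    (fun k => fderiv ℝ φ x (EuclideanSpace.single k 1)) (φ x)
    (M := fun b => F x b.1 b.2) hdx
    (D := fun k b => D k b x) hDx).symm

lemma MemSobolevVec.memLp_weakJacobian {n m : ℕ} {Ω : Set (EuclideanSpace ℝ (Fin n))}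
    {p : ENNReal} {u : EuclideanSpace ℝ (Fin n) → EuclideanSpace ℝ (Fin m)}
    {G : EuclideanSpace ℝ (Fin n) → Matrix (Fin m) (Fin n) ℝ} (hΩ : IsOpen Ω)
    (hu : MemSobolevVec Ω p 1 u) (hG : IsWeakJacobian Ω u G) (i : Fin m) (j : Fin n) :
    MemLp (fun x => G x i j) p (volume.restrict Ω) := by
  obtain ⟨v, hv, hvp⟩ := (hu i).2 j
  exact (memLp_congr_ae (hv.ae_unique hΩ (hG i j))).1 hvp

lemma MemSobolevVec.exists_weakPartial_weakJacobian {n m : ℕ}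
    {Ω : Set (EuclideanSpace ℝ (Fin n))} {p : ENNReal}
    {u : EuclideanSpace ℝ (Fin n) → EuclideanSpace ℝ (Fin m)}
    {G : EuclideanSpace ℝ (Fin n) → Matrix (Fin m) (Fin n) ℝ} (hΩ : IsOpen Ω)
    (hu : MemSobolevVec Ω p 2 u) (hG : IsWeakJacobian Ω u G) (k : Fin n) (b : Fin m × Fin n) :
    ∃ d, HasWeakPartial Ω k (fun x => G x b.1 b.2) d ∧ MemLp d p (volume.restrict Ω) := by
  obtain ⟨v, hv, -, hvk⟩ := (hu b.1).2 b.2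
  obtain ⟨d, hd, hdp⟩ := hvk k
  exact ⟨d, hd.congr (hv.ae_unique hΩ (hG b.1 b.2)) ae_eq_rfl, hdp⟩

lemma MeasureTheory.MemLp.exists_ae_bound {X : Type*} [MeasurableSpace X] {μ : Measure X}
    {f : X → ℝ} (hf : MemLp f ⊤ μ) : ∃ C, 0 ≤ C ∧ ∀ᵐ x ∂μ, |f x| ≤ C := by
  refine ⟨(eLpNorm f ⊤ μ).toReal, ENNReal.toReal_nonneg, ?_⟩
  filter_upwards [ae_le_eLpNormEssSup (f := f) (μ := μ)] with x hx
  rw [← eLpNorm_exponent_top] at hx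
  simpa using ENNReal.toReal_mono hf.2.ne hx

lemma memLp_axialVector {p : ENNReal} {c M : ℝ} (hc : 0 < c)
    {W F : EuclideanSpace ℝ (Fin 3) → Matrix (Fin 3) (Fin 3) ℝ}
    (hWp : ∀ i j, MemLp (fun x => W x i j) p (volume.restrict Ω))
    (hFm : ∀ b : Fin 3 × Fin 3, AEStronglyMeasurable (fun x => F x b.1 b.2) (volume.restrict Ω))
    (hF : ∀ b : Fin 3 × Fin 3, ∀ᵐ x ∂(volume.restrict Ω), |F x b.1 b.2| ≤ M) (i : Fin 3) :
    MemLp (fun x => axialVector c (W x) (F x) i) p (volume.restrict Ω) := by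
  refine memLp_finsetSum _ fun k _ => ?_
  have hG : Continuous fun y : Fin 3 × Fin 3 → ℝ => cutoffInv c (entriesDet y) *
      (Matrix.of fun a b => y (a, b)).adjugate k (i + 1) := by
    refine ((contDiff_cutoffInv hc).comp contDiff_entriesDet).continuous.mul ?_
    have h1 : Continuous fun y : Fin 3 × Fin 3 → ℝ => Matrix.of fun a b => y (a, b) :=
      continuous_matrix fun a b => continuous_apply (a, b)
    exact h1.matrix_adjugate.matrix_elem k (i + 1)
  obtain ⟨C, hC⟩ := exists_ae_bound_comp hF hG
  exact MemLp.mul (p := p) (q := ⊤) (r := p)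
    (memLp_top_of_bound (aestronglyMeasurable_comp hFm hG) C hC) (hWp (i + 2) k)

end Rigidity

theorem theorem3
    (Ω : Set (EuclideanSpace ℝ (Fin 3))) (hΩ : IsLipschitzDomain Ω)
    (p q : ℝ) (hp : 1 < p) (hq : 1 < q) (hpq : 1 / p + 1 / q = 1)
    (Φ Ψ : EuclideanSpace ℝ (Fin 3) → EuclideanSpace ℝ (Fin 3))
    (hΦ : MemSobolevVec Ω (ENNReal.ofReal p) 1 Φ)
    (hΨ₁ : MemSobolevVec Ω ⊤ 1 Ψ)
    (hΨ₂ : MemSobolevVec Ω (ENNReal.ofReal q) 2 Ψ)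
    (gradΦ gradΨ : EuclideanSpace ℝ (Fin 3) → Matrix (Fin 3) (Fin 3) ℝ)
    (hgradΦ : IsWeakJacobian Ω Φ gradΦ) (hgradΨ : IsWeakJacobian Ω Ψ gradΨ)
    (c : ℝ) (hc : 0 < c)
    (hdet : ∀ᵐ x ∂(volume.restrict Ω), c ≤ (gradΨ x).det)
    (hsym : ∀ᵐ x ∂(volume.restrict Ω), symPart ((gradΦ x)ᵀ * gradΨ x) = 0) :
    ∃ A ∈ LieAlgebra.Orthogonal.so (Fin 3) ℝ, ∃ a : EuclideanSpace ℝ (Fin 3),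
      ∀ᵐ x ∂(volume.restrict Ω), Φ x = WithLp.toLp 2 (A *ᵥ (Ψ x).ofLp) + a := by
  obtain ⟨hopen, hconn, -⟩ := hΩ
  have hpq' : (ENNReal.ofReal p).HolderConjugate (ENNReal.ofReal q) :=
    (Real.holderConjugate_iff.2 ⟨hp, by simpa using hpq⟩).ennrealOfReal
  have hp1 : 1 ≤ ENNReal.ofReal p := by simpa using ENNReal.ofReal_le_ofReal hp.le
  have hq1 : 1 ≤ ENNReal.ofReal q := by simpa using ENNReal.ofReal_le_ofReal hq.le
  have hWp := hΦ.memLp_weakJacobian hopen hgradΦ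
  choose D hFD hDq using hΨ₂.exists_weakPartial_weakJacobian hopen hgradΨ
  choose C hC0 hC using fun i j => (hΨ₁.memLp_weakJacobian hopen hgradΨ i j).exists_ae_bound
  obtain ⟨M, hM0, hM⟩ : ∃ M : ℝ, 0 ≤ M ∧ ∀ i j, C i j ≤ M :=
    ⟨∑ i, ∑ j, C i j, Finset.sum_nonneg fun i _ => Finset.sum_nonneg fun j _ => hC0 i j,
      fun i j => (Finset.single_le_sum (fun j _ => hC0 i j) (Finset.mem_univ j)).trans
        (Finset.single_le_sum (f := fun i => ∑ j, C i j)
          (fun i _ => Finset.sum_nonneg fun j _ => hC0 i j) (Finset.mem_univ i))⟩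
  have hF (b : Fin 3 × Fin 3) : ∀ᵐ x ∂(volume.restrict Ω), |gradΨ x b.1 b.2| ≤ M := by
    filter_upwards [hC b.1 b.2] with x hx using hx.trans (hM _ _)
  have hD : ∀ᵐ x ∂(volume.restrict Ω), ∀ i j k, D k (i, j) x = D j (i, k) x := by
    simp only [ae_all_iff]
    exact fun i j k => ((hgradΨ i j).swap (hgradΨ i k) (hFD k (i, j))).ae_unique hopen
      (hFD j (i, k))
  -- Halving c makes the determinant bound strict, as differentiating the algebraic identity
  -- requires.
  have hc2 : 0 < c / 2 := half_pos hc
  have hdet' : ∀ᵐ x ∂(volume.restrict Ω), c / 2 < (gradΨ x).det := by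
    filter_upwards [hdet] with x hx using (half_lt_self hc).trans_le hx
  have haW : ∀ᵐ x ∂(volume.restrict Ω), ∀ i j,
      axialMul (axialVector (c / 2) (gradΦ x) (gradΨ x)) (fun b => gradΨ x b.1 b.2) i j =
        gradΦ x i j := by
    filter_upwards [hdet', hsym] with x hx hs i j using axialMul_axialVector hc2 hx.le hs i j
  have ha (m : Fin 3) : LocallyIntegrableOn
      (fun x => axialVector (c / 2) (gradΦ x) (gradΨ x) m) Ω volume :=
    locallyIntegrableOn_of_locallyIntegrable_restrict ((memLp_axialVector hc2 hWp
      (fun b => (hgradΨ b.1 b.2).2.1.aestronglyMeasurable) hF m).locallyIntegrable hp1)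
  choose α hα using fun m => HasWeakPartial.ae_eq_const hopen hconn
    (hasWeakPartial_axial_zero hp1 hq1 ENNReal.ofReal_ne_top hopen hc2 hM0 hgradΦ hWp hF hFD hDq
      hD hdet' ha haW m) (ha m)
  -- Component i of Φ - α × Ψ, whose weak gradient vanishes because W = α × F.
  have hu (i : Fin 3) (j : Fin 3) := (hgradΦ i j).add
    (((hgradΨ (i + 2) j).const_mul (-α (i + 1))).add ((hgradΨ (i + 1) j).const_mul (α (i + 2))))
  have hu0 (i : Fin 3) (j : Fin 3) := (hu i j).congr ae_eq_rfl (v' := 0) (by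
    filter_upwards [haW, ae_all_iff.2 hα] with x hx hαx
    rw [← hx, axialMul, hαx, hαx, Pi.zero_apply]
    ring)
  choose a hconst using fun i => HasWeakPartial.ae_eq_const hopen hconn (hu0 i) (hu0 i 0).1
  refine ⟨!![0, -α 2, α 1; α 2, 0, -α 0; -α 1, α 0, 0], ?_, WithLp.toLp 2 a, ?_⟩
  · rw [LieAlgebra.Orthogonal.mem_so]
    ext i j
    fin_cases i <;> fin_cases j <;> simp
  · filter_upwards [ae_all_iff.2 hconst] with x hx
    have h0 := hx 0
    have h1 := hx 1
    have h2 := hx 2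
    have e1 : (1 : Fin 3) + 1 = 2 := rfl
    have e2 : (1 : Fin 3) + 2 = 0 := rfl
    have e3 : (2 : Fin 3) + 1 = 0 := rfl
    have e4 : (2 : Fin 3) + 2 = 1 := rfl
    simp only [zero_add, e1, e2, e3, e4] at h0 h1 h2
    ext i
    fin_cases i <;> simp [dotProduct, Fin.sum_univ_three]
    · linarith
    · linarith
    · linarith
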